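/- Let $G=(0,\pi)$, $(g,h)_0=\int_0^\pi g(x)h(x)\,dx$, $\|h\|_0^2=(h,h)_0$, and let $H^1_0(G)$ be the closure of the smooth functions with compact support in $G$ with respect to the norm $\|h\|_1^2=\|h\|_0^2+\|h'\|_0^2$. Let $0<T<\infty$, $W\in L_\infty(G)$ and $\varphi\in L_2(G)$. A generalized geometric rough path (GRP) solution on $(0,T)$ of the problem $$u_t=u_{xx}+u\dot W,\quad u|_{t=0}=\varphi,\quad u|_{x=0}=u|_{x=\pi}=0,$$ is by definition a generalized solution of $u_t=(u_x+uW)_x-u_xW$ with the same initial and boundary conditions, that is, an element $u$ of $L_2\big((0,T);H^1_0(G)\big)$ that has an $L_2(G)$-valued version (again denoted by $u$) such that, for every $h\in H^1_0(G)$ and every $t\in(0,T)$, $$(u(t),h)_0=(\varphi,h)_0-\int_0^t\big(u_x+uW,h'\big)_0(s)\,ds-\int_0^t\big(u_xW,h\big)_0(s)\,ds .$$ **Theorem 3.1.** There is a function $C=C(T,K)$ such that, for all $0<T<\infty$, $W\in L_\infty(G)$ and $\varphi\in L_2(G)$, a generalized GRP solution $u$ exists and is unique as an element of $L_2\big((0,T);H^1_0(G)\big)$;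 moreover, it has a version in $\mathcal C\big((0,T);L_2(G)\big)$, and, for this version, $$\sup_{t\in(0,T)}\|u(t)\|_0^2+\int_0^T\|u(s)\|_1^2\,ds\le C\big(T,\|W\|_{L_\infty(G)}\big)\,\|\varphi\|_0^2 .$$ -/

import Mathlib

open MeasureTheory Set
open scoped ENNReal ContDiff

noncomputable section

namespace HeatGRP

/-- Lebesgue measure on the interval `G = (0, π)`. -/
abbrev spaceMeasure : Measure ℝ := volume.restrict (Ioo 0 Real.pi)

/-- Lebesgue measure on the time interval `(0, T)`. -/
abbrev timeMeasure (T : ℝ) : Measure ℝ := volume.restrict (Ioo 0 T)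

/-- The real Hilbert space `L₂(G)`. Its norm is `‖·‖₀`. -/
abbrev L2G : Type := Lp ℝ 2 spaceMeasure

/-- The Banach space `L_∞(G)`. -/
abbrev LinftyG : Type := Lp ℝ ∞ spaceMeasure

/-- A smooth function with compact support contained in `G = (0, π)`. -/
def IsTestFunction (h : ℝ → ℝ) : Prop :=
  ContDiff ℝ ∞ h ∧ HasCompactSupport h ∧ tsupport h ⊆ Ioo 0 Real.pi

/-- The smooth functions with compact support in `G`, each embedded as the pair `(h, h')` into
the Hilbert space `L₂(G) × L₂(G)`, whose norm is `(‖f‖₀² + ‖g‖₀²)^(1/2)`. The norm of `(h, h')`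
is thus `‖h‖₁ = (‖h‖₀² + ‖h'‖₀²)^(1/2)`. -/
def testGraph : Submodule ℝ (WithLp 2 (L2G × L2G)) where
  carrier := {p | ∃ h : ℝ → ℝ, IsTestFunction h ∧
    p.fst =ᵐ[spaceMeasure] h ∧ p.snd =ᵐ[spaceMeasure] deriv h}
  zero_mem' := by
    refine ⟨fun _ => 0, ⟨contDiff_const, HasCompactSupport.zero, ?_⟩, ?_, ?_⟩
    · simp [tsupport, Function.support]
    · exact Lp.coeFn_zero ℝ 2 spaceMeasure
    · have h0 : deriv (fun _ : ℝ => (0 : ℝ)) = 0 := by ext x; simp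
      rw [h0]
      exact Lp.coeFn_zero ℝ 2 spaceMeasure
  add_mem' := by
    rintro p q ⟨h, ⟨hs, hc, hG⟩, hf, hd⟩ ⟨k, ⟨ks, kc, kG⟩, kf, kd⟩
    refine ⟨h + k, ⟨hs.add ks, hc.add kc, ?_⟩, ?_, ?_⟩
    · exact (tsupport_add h k).trans (union_subset hG kG)
    · exact (Lp.coeFn_add p.fst q.fst).trans (hf.add kf)
    · have hdk : deriv (h + k) = deriv h + deriv k := by
        ext x
        exact deriv_add (hs.differentiable (by simp) x) (ks.differentiable (by simp) x)
      rw [hdk]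
      exact (Lp.coeFn_add p.snd q.snd).trans (hd.add kd)
  smul_mem' := by
    rintro c p ⟨h, ⟨hs, hc, hG⟩, hf, hd⟩
    refine ⟨c • h, ⟨contDiff_const.smul hs, hc.smul_left, ?_⟩, ?_, ?_⟩
    · exact (closure_mono (Function.support_const_smul_subset c h)).trans hG
    · exact (Lp.coeFn_smul c p.fst).trans (hf.const_smul c)
    · have hdc : deriv (c • h) = c • deriv h := by
        ext x
        exact deriv_const_smul c (hs.differentiable (by simp) x)
      rw [hdc]
      exact (Lp.coeFn_smul c p.snd).trans (hd.const_smul c)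

/-- The Sobolev space `H¹₀(G)`: the closure of the smooth functions with compact support in `G`
with respect to `‖·‖₁`. An element is stored together with its generalized derivative, as a pair
`(h, h')`, and carries the norm `‖·‖₁`. -/
abbrev H10 : Type := (testGraph.topologicalClosure : Submodule ℝ (WithLp 2 (L2G × L2G)))

/-- The element of `L₂(G)` underlying an element of `H¹₀(G)`. -/
def H10.val (h : H10) : L2G := (h : WithLp 2 (L2G × L2G)).fst

/-- The generalized derivative of an element of `H¹₀(G)`. -/
def H10.dx (h : H10) : L2G := (h : WithLp 2 (L2G × L2G)).snd

theorem H10.norm_sq (h : H10) : ‖h‖ ^ 2 = ‖h.val‖ ^ 2 + ‖h.dx‖ ^ 2 :=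
  WithLp.prod_norm_sq_eq_of_L2 (h : WithLp 2 (L2G × L2G))

/-- The Bochner space `L₂((0, T); H¹₀(G))`. -/
abbrev L2H10 (T : ℝ) : Type := Lp H10 2 (timeMeasure T)

/-- `w` is a version, as a function on `(0, T)` with values in `L₂(G)`, of the
equivalence class `v ∈ L₂((0, T); H¹₀(G))`. -/
def IsL2Version (T : ℝ) (v : L2H10 T) (w : ℝ → L2G) : Prop :=
  ∀ᵐ t ∂(timeMeasure T), w t = (v t).val

/-- `v ∈ L₂((0, T); H¹₀(G))` is a generalized solution of
`v_t = (v_x + a v)_x + b v_x + c v + f` on `(0, T) × G` with initial condition `φ` and zero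
Dirichlet boundary conditions: for every `h ∈ H¹₀(G)` and every `t ∈ (0, T)`,
`(v(t), h)₀ = (φ, h)₀ - ∫₀ᵗ (v_x + a v, h')₀ ds + ∫₀ᵗ (b v_x + c v, h)₀ ds + ∫₀ᵗ [f, h]₀ ds`.
Since `v` is an equivalence class of functions of `t`, its value at each single time `t` is that
of a version `w` of `v` (the same for all `h` and `t`). -/
def IsGeneralizedSolution (T : ℝ) (a b c : ℝ → ℝ → ℝ) (f : ℝ → StrongDual ℝ H10)
    (φ : L2G) (v : L2H10 T) : Prop :=
  ∃ w : ℝ → L2G, IsL2Version T v w ∧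
    ∀ h : H10, ∀ t ∈ Ioo 0 T,
      ∫ x, w t x * h.val x ∂spaceMeasure =
        (∫ x, φ x * h.val x ∂spaceMeasure)
        - (∫ s in (0 : ℝ)..t,
            ∫ x, ((v s).dx x + a s x * (v s).val x) * h.dx x ∂spaceMeasure)
        + (∫ s in (0 : ℝ)..t,
            ∫ x, (b s x * (v s).dx x + c s x * (v s).val x) * h.val x ∂spaceMeasure)
        + ∫ s in (0 : ℝ)..t, f s h

/-- The generalized geometric rough path solution of `u_t = u_xx + u Ẇ`, `u(0, ·) = φ`,
`u(t, 0) = u(t, π) = 0`: the generalized solution of `u_t = (u_x + u W)_x - u_x W`. -/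
def IsGeneralizedGRPSolution (T : ℝ) (W : LinftyG) (φ : L2G) (u : L2H10 T) : Prop :=
  IsGeneralizedSolution T (fun _ x => W x) (fun _ x => -W x) (fun _ _ => 0) (fun _ => 0) φ u

end HeatGRP

end

/-! The equation reads `(u', h)₀ + a(u, h) = 0` with `a(u, h) = (u_x + uW, h')₀ + (u_x W, h)₀`. The
two terms in `W` are transposes of each other, so `a` is symmetric although `W` is merely bounded.
Young's inequality gives the Gårding bound `½‖v‖₁² ≤ a(v, v) + λ‖v‖₀²` with `λ = 2‖W‖² + ½`
(`grpForm_garding`). The embedding of `H¹₀(G)` in `L₂(G)` is compact (`isCompactOperator_valL`), so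
the spectral theorem for the resolvent shows that the eigenvectors of `a` span a dense subspace of
`L₂(G)` (`eigenSpan_orthogonal_eq_bot`).

Existence (`exists_weakSolution`): an eigenvector `e` with eigenvalue `κ` evolves as `exp(-κt) e`.
The energy inequality bounds such solutions by their initial values alone, so the closure of the set
of solutions still projects onto a closed subspace of initial values; this subspace is dense, hence
everything.

Uniqueness (`weakSolution_eq_zero`): paired with an eigenvector, a solution with zero data satisfies
a scalar linear equation `g = -κ ∫₀ g`, which forces it to vanish. Density of the eigenvectors and
injectivity of the embedding finish the proof. -/

open scoped InnerProductSpace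

noncomputable section

namespace HeatGRP

/-! ### Symmetric forms with a Gårding inequality: eigenvectors and energy -/

section Abstract

variable {V H : Type*} [NormedAddCommGroup V] [InnerProductSpace ℝ V]
  [NormedAddCommGroup H] [InnerProductSpace ℝ H]

/-- The span in `H` of the eigenvectors of the form `a` relative to the inner product of `H`. -/
def eigenSpan (i : V →L[ℝ] H) (a : V →L[ℝ] V →L[ℝ] ℝ) : Submodule ℝ H :=
  Submodule.span ℝ {x | ∃ (e : V) (κ : ℝ), i e = x ∧ ∀ v, a e v = κ * ⟪x, i v⟫_ℝ}

/-- The shifted form `B = a + lam ⟪i ·, i ·⟫` is coercive, so Lax–Milgram gives `R` with `B (R x) v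
= ⟪x, i v⟫`. Then `S = i ∘ R` is compact and symmetric, and its eigenvectors are total in `H`; it
remains to turn each of them into an eigenvector of `a`. -/
theorem eigenSpan_orthogonal_eq_bot [CompleteSpace V] [CompleteSpace H] {i : V →L[ℝ] H} {a : V →L[ℝ] V →L[ℝ] ℝ}
    (hi : IsCompactOperator i) (hdense : ∀ x : H, (∀ v, ⟪x, i v⟫_ℝ = 0) → x = 0)
    (hsymm : ∀ u v, a u v = a v u) {α lam : ℝ} (hα : 0 < α)
    (hcoer : ∀ v, α * ‖v‖ ^ 2 ≤ a v v + lam * ‖i v‖ ^ 2) :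
    (eigenSpan i a)ᗮ = ⊥ := by
  set B : V →L[ℝ] V →L[ℝ] ℝ := a + lam • (isBoundedBilinearMap_inner (𝕜 := ℝ) (E := H)).toContinuousLinearMap.bilinearComp i i
    with hB
  have hBapp : ∀ u v, B u v = a u v + lam * ⟪i u, i v⟫_ℝ := fun u v => by simp [hB]
  have hBcoer : IsCoercive B := by
    refine ⟨α, hα, fun v => ?_⟩
    rw [hBapp, real_inner_self_eq_norm_sq]
    linarith [hcoer v]
  have hBsymm : ∀ u v, B u v = B v u := fun u v => by
    rw [hBapp, hBapp, hsymm, real_inner_comm]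
  set R : H →L[ℝ] V :=
    (hBcoer.continuousLinearEquivOfBilin.symm : V →L[ℝ] V) ∘L ContinuousLinearMap.adjoint i with hR
  have hRapp : ∀ x v, B (R x) v = ⟪x, i v⟫_ℝ := fun x v => by
    rw [← hBcoer.continuousLinearEquivOfBilin_apply]
    simp [hR, ContinuousLinearMap.adjoint_inner_left]
  set S : H →L[ℝ] H := i ∘L R with hS
  have hScomp : IsCompactOperator S := hi.comp_clm R
  have hSsymm : (S : H →ₗ[ℝ] H).IsSymmetric := fun x y => by
    change ⟪i (R x), y⟫_ℝ = ⟪x, i (R y)⟫_ℝ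
    rw [real_inner_comm, ← hRapp, ← hRapp, hBsymm]
  have hle : (⨆ μ, Module.End.eigenspace (S : Module.End ℝ H) μ) ≤ eigenSpan i a := by
    refine iSup_le fun μ x hx => ?_
    have hx' : i (R x) = μ • x := Module.End.mem_eigenspace_iff.mp hx
    rcases eq_or_ne μ 0 with rfl | hμ
    -- The kernel of `S` is trivial: coercivity gives `R x = 0`, so `x` is orthogonal to the dense
    -- range of `i`.
    · have h0 : B (R x) (R x) = 0 := by rw [hRapp, hx']; simp
      have hR0 : R x = 0 := by
        obtain ⟨c, hc, hcB⟩ := hBcoer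
        have := hcB (R x)
        rw [h0] at this
        by_contra hne
        have : 0 < ‖R x‖ := norm_pos_iff.mpr hne
        have : 0 < c * ‖R x‖ * ‖R x‖ := by positivity
        linarith
      have : x = 0 := hdense x fun v => by rw [← hRapp, hR0]; simp
      rw [this]; exact Submodule.zero_mem _
    -- For `S x = μ x`, the vector `e = μ⁻¹ R x` has `i e = x` and `B e v = μ⁻¹ ⟪x, i v⟫`; removing
    -- the shift leaves the eigenvalue `μ⁻¹ - lam`.
    · refine Submodule.subset_span ⟨μ⁻¹ • R x, μ⁻¹ - lam, ?_, fun v => ?_⟩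
      · rw [map_smul, hx', inv_smul_smul₀ hμ]
      · have h1 := hRapp x v
        rw [hBapp, hx', inner_smul_left] at h1
        simp only [map_smul, smul_apply, smul_eq_mul, conj_trivial] at h1 ⊢
        field_simp
        linarith
  have := ContinuousLinearMap.orthogonalComplement_iSup_eigenspaces_eq_bot hScomp hSsymm
  exact le_bot_iff.mp (this ▸ Submodule.orthogonal_le hle)

/-- `u`, differentiable with derivative `u'`, solves `⟪i u', i v⟫ + a u v = 0` for all `v`. -/
def IsStrongSolution (i : V →L[ℝ] H) (a : V →L[ℝ] V →L[ℝ] ℝ) (u : ℝ → V) : Prop :=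
  ∃ u' : ℝ → V, (∀ t, HasDerivAt u (u' t) t) ∧ ∀ t v, ⟪i (u' t), i v⟫_ℝ = -a (u t) v

theorem IsStrongSolution.continuous {i : V →L[ℝ] H} {a : V →L[ℝ] V →L[ℝ] ℝ} {u : ℝ → V}
    (hu : IsStrongSolution i a u) : Continuous u := by
  obtain ⟨u', hu', -⟩ := hu
  exact continuous_iff_continuousAt.mpr fun t => (hu' t).continuousAt

theorem IsStrongSolution.add {i : V →L[ℝ] H} {a : V →L[ℝ] V →L[ℝ] ℝ} {u v : ℝ → V}
    (hu : IsStrongSolution i a u) (hv : IsStrongSolution i a v) : IsStrongSolution i a (u + v) := by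
  obtain ⟨u', hu', hau⟩ := hu
  obtain ⟨v', hv', hav⟩ := hv
  refine ⟨u' + v', fun t => (hu' t).add (hv' t), fun t x => ?_⟩
  simp only [Pi.add_apply, map_add, inner_add_left, hau, hav, add_apply]
  ring

theorem IsStrongSolution.smul {i : V →L[ℝ] H} {a : V →L[ℝ] V →L[ℝ] ℝ} {u : ℝ → V} (c : ℝ)
    (hu : IsStrongSolution i a u) : IsStrongSolution i a (c • u) := by
  obtain ⟨u', hu', hau⟩ := hu
  refine ⟨c • u', fun t => (hu' t).const_smul c, fun t x => ?_⟩
  simp [inner_smul_left, hau]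

theorem IsStrongSolution.exp_smul {i : V →L[ℝ] H} {a : V →L[ℝ] V →L[ℝ] ℝ} {e : V} {κ : ℝ}
    (he : ∀ v, a e v = κ * ⟪i e, i v⟫_ℝ) :
    IsStrongSolution i a fun t => Real.exp (-κ * t) • e := by
  refine ⟨fun t => (Real.exp (-κ * t) * (-κ)) • e, fun t => ?_, fun t v => ?_⟩
  · have h : HasDerivAt (fun t : ℝ => Real.exp (-κ * t)) (Real.exp (-κ * t) * (-κ)) t := by
      simpa using ((hasDerivAt_id t).const_mul (-κ)).exp
    exact h.smul_const e
  · simp [inner_smul_left, he]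
    ring

/-- Weak form of a strong solution. -/
theorem IsStrongSolution.inner_eq {i : V →L[ℝ] H} {a : V →L[ℝ] V →L[ℝ] ℝ} {u : ℝ → V}
    (hu : IsStrongSolution i a u) (t : ℝ) (v : V) :
    ⟪i (u t), i v⟫_ℝ = ⟪i (u 0), i v⟫_ℝ - ∫ s in (0 : ℝ)..t, a (u s) v := by
  have hc := hu.continuous
  obtain ⟨u', hu', hau⟩ := hu
  have hd : ∀ s, HasDerivAt (fun s => ⟪i (u s), i v⟫_ℝ) (-a (u s) v) s := fun s => by
    have h1 : HasDerivAt (fun s => i (u s)) (i (u' s)) s := i.hasFDerivAt.comp_hasDerivAt s (hu' s)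
    have := h1.inner ℝ (hasDerivAt_const s (i v))
    simpa [hau] using this
  have hci : Continuous fun s => -a (u s) v := by fun_prop
  have := intervalIntegral.integral_eq_sub_of_hasDerivAt (a := 0) (b := t) (fun s _ => hd s)
    (hci.intervalIntegrable _ _)
  rw [intervalIntegral.integral_neg] at this
  linarith

/-- The weight `exp(-2 lam t)` absorbs the zero-order term of the Gårding inequality: the derivative
of the weighted `‖i u‖²` is at most `-2α‖u‖²` times the weight. Integrate from `0` to `t`. -/
theorem IsStrongSolution.energy {i : V →L[ℝ] H} {a : V →L[ℝ] V →L[ℝ] ℝ} {u : ℝ → V}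
    (hu : IsStrongSolution i a u) {α lam : ℝ}
    (hcoer : ∀ v, α * ‖v‖ ^ 2 ≤ a v v + lam * ‖i v‖ ^ 2) {t : ℝ} (ht : 0 ≤ t) :
    Real.exp (-(2 * lam) * t) * ‖i (u t)‖ ^ 2
      + ∫ s in (0 : ℝ)..t, Real.exp (-(2 * lam) * s) * (2 * α * ‖u s‖ ^ 2) ≤ ‖i (u 0)‖ ^ 2 := by
  have hc := hu.continuous
  obtain ⟨u', hu', hau⟩ := hu
  have hd : ∀ s, HasDerivAt (fun s => Real.exp (-(2 * lam) * s) * ‖i (u s)‖ ^ 2)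
      (Real.exp (-(2 * lam) * s) * (-(2 * lam) * ‖i (u s)‖ ^ 2 - 2 * a (u s) (u s))) s :=
    fun s => by
      have h1 : HasDerivAt (fun s => i (u s)) (i (u' s)) s :=
        i.hasFDerivAt.comp_hasDerivAt s (hu' s)
      have h2 : HasDerivAt (fun t : ℝ => Real.exp (-(2 * lam) * t))
          (Real.exp (-(2 * lam) * s) * (-(2 * lam))) s := by
        simpa using ((hasDerivAt_id s).const_mul (-(2 * lam))).exp
      have h3 := h2.mul h1.norm_sq
      refine h3.congr_deriv ?_
      rw [real_inner_comm, hau]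
      ring
  have hci : Continuous fun s =>
      Real.exp (-(2 * lam) * s) * (-(2 * lam) * ‖i (u s)‖ ^ 2 - 2 * a (u s) (u s)) := by fun_prop
  have hcr : Continuous fun s => Real.exp (-(2 * lam) * s) * (2 * α * ‖u s‖ ^ 2) := by fun_prop
  have h := intervalIntegral.integral_eq_sub_of_hasDerivAt (a := 0) (b := t) (fun s _ => hd s)
    (hci.intervalIntegrable _ _)
  have hmono := intervalIntegral.integral_mono_on (μ := volume) ht
    (hcr.intervalIntegrable 0 t) (hci.neg.intervalIntegrable 0 t) (fun s _ => by
      refine (mul_le_mul_of_nonneg_left ?_ (Real.exp_pos _).le).trans_eq (mul_neg _ _)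
      linarith [hcoer (u s)])
  simp only [Pi.neg_apply] at hmono
  rw [intervalIntegral.integral_neg, h] at hmono
  simp only [mul_zero, Real.exp_zero, one_mul] at hmono
  linarith

end Abstract

/-! ### Existence by closing the graph of strong solutions -/

section Existence

variable {V H : Type*} [NormedAddCommGroup V] [InnerProductSpace ℝ V]
  [NormedAddCommGroup H] [InnerProductSpace ℝ H]

theorem ae_restrict_Ioc_of_ae_timeMeasure {T t : ℝ} (ht : t < T) {p : ℝ → Prop}
    (h : ∀ᵐ s ∂timeMeasure T, p s) : ∀ᵐ s ∂volume.restrict (Ioc 0 t), p s :=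
  ae_restrict_of_ae_restrict_of_subset
    (show Ioc 0 t ⊆ Ioo 0 T from fun _ hs => ⟨hs.1, hs.2.trans_lt ht⟩) h

theorem memLp_IccExtend {E : Type*} [NormedAddCommGroup E] {T : ℝ} (hT : 0 ≤ T)
    (w : C(Icc 0 T, E)) :
    MemLp (IccExtend hT w) 2 (timeMeasure T) :=
  MemLp.of_bound w.continuous.Icc_extend'.aestronglyMeasurable ‖w‖
    (Filter.Eventually.of_forall fun _ => w.norm_coe_le_norm _)

/-- The class in `L₂((0, T); H)` of a continuous function on `[0, T]`. -/
def continuousToL2 {T : ℝ} (hT : 0 ≤ T) : C(Icc 0 T, H) →L[ℝ] Lp H 2 (timeMeasure T) :=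
  LinearMap.mkContinuous
    { toFun := fun w => (memLp_IccExtend hT w).toLp _
      map_add' := fun _ _ => rfl
      map_smul' := fun _ _ => rfl }
    ((timeMeasure T univ).toReal ^ ((2 : ℝ≥0∞).toReal⁻¹)) fun w => by
      refine Lp.norm_le_of_ae_bound (norm_nonneg w) ?_
      filter_upwards [(memLp_IccExtend hT w).coeFn_toLp] with t ht
      change ‖(memLp_IccExtend hT w).toLp _ t‖ ≤ ‖w‖
      rw [ht]
      exact w.norm_coe_le_norm _

theorem continuousToL2_ae {T : ℝ} (hT : 0 ≤ T) (w : C(Icc 0 T, H)) :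
    continuousToL2 hT w =ᵐ[timeMeasure T] IccExtend hT w :=
  (memLp_IccExtend hT w).coeFn_toLp

/-- Initial value, trace in `H` and class in `L₂((0, T); V)` of the strong solutions. -/
def strongSolutions (i : V →L[ℝ] H) (a : V →L[ℝ] V →L[ℝ] ℝ) (T : ℝ) :
    Submodule ℝ (H × C(Icc 0 T, H) × Lp V 2 (timeMeasure T)) where
  carrier := {p | ∃ u, IsStrongSolution i a u ∧ i (u 0) = p.1 ∧ (∀ t, p.2.1 t = i (u t)) ∧
    p.2.2 =ᵐ[timeMeasure T] u}
  zero_mem' := by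
    refine ⟨0, ⟨0, fun t => hasDerivAt_const t 0, by simp⟩, by simp, by simp, ?_⟩
    exact Lp.coeFn_zero V 2 _
  add_mem' := by
    rintro p q ⟨u, hu, hu0, huw, hup⟩ ⟨v, hv, hv0, hvw, hvp⟩
    refine ⟨u + v, hu.add hv, by simp [hu0, hv0], by simp [huw, hvw], ?_⟩
    exact (Lp.coeFn_add _ _).trans (hup.add hvp)
  smul_mem' := by
    rintro c p ⟨u, hu, hu0, huw, hup⟩
    refine ⟨c • u, hu.smul c, by simp [hu0], by simp [huw], ?_⟩
    exact (Lp.coeFn_smul _ _).trans (hup.const_smul c)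

theorem memLp_timeMeasure_of_continuous {E : Type*} [NormedAddCommGroup E] {T : ℝ} {u : ℝ → E}
    (hu : Continuous u) : MemLp u 2 (timeMeasure T) := by
  obtain ⟨C, hC⟩ := (isCompact_Icc (a := (0 : ℝ)) (b := T)).exists_bound_of_continuousOn
    hu.continuousOn
  refine MemLp.of_bound hu.aestronglyMeasurable C ?_
  filter_upwards [ae_restrict_mem measurableSet_Ioo] with t ht
  exact hC t (Ioo_subset_Icc_self ht)

theorem eigenSpan_le_map_strongSolutions (i : V →L[ℝ] H) (a : V →L[ℝ] V →L[ℝ] ℝ) (T : ℝ) :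
    eigenSpan i a ≤ (strongSolutions i a T).map (LinearMap.fst ℝ _ _) := by
  refine Submodule.span_le.mpr ?_
  rintro _ ⟨e, κ, rfl, he⟩
  have hs := IsStrongSolution.exp_smul he
  have hc := hs.continuous
  refine ⟨(i e, ⟨fun t => i (Real.exp (-κ * t) • e), by fun_prop⟩,
    (memLp_timeMeasure_of_continuous hc).toLp _), ⟨_, hs, ?_, ?_, ?_⟩, rfl⟩
  · simp
  · intro t; rfl
  · exact MemLp.coeFn_toLp (memLp_timeMeasure_of_continuous hc)

theorem norm_sq_eq_intervalIntegral {T : ℝ} (hT : 0 ≤ T) (u : Lp V 2 (timeMeasure T)) :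
    ‖u‖ ^ 2 = ∫ s in (0 : ℝ)..T, ‖u s‖ ^ 2 := by
  rw [← real_inner_self_eq_norm_sq, L2.inner_def, intervalIntegral.integral_of_le hT,
    integral_Ioc_eq_integral_Ioo]
  simp_rw [real_inner_self_eq_norm_sq]

/-- Both terms on the left of the energy inequality are nonnegative, so each is bounded separately;
since `lam ≥ 0`, the weight is at least `exp(-2 lam T)` on `[0, T]` and can be divided out. -/
theorem strongSolutions_bound {i : V →L[ℝ] H} {a : V →L[ℝ] V →L[ℝ] ℝ} {T α lam : ℝ} (hT : 0 ≤ T)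
    (hα : 0 < α) (hlam : 0 ≤ lam) (hcoer : ∀ v, α * ‖v‖ ^ 2 ≤ a v v + lam * ‖i v‖ ^ 2)
    {p : H × C(Icc 0 T, H) × Lp V 2 (timeMeasure T)} (hp : p ∈ strongSolutions i a T) :
    ‖p.2.1‖ ^ 2 ≤ Real.exp (2 * lam * T) * ‖p.1‖ ^ 2 ∧
      ‖p.2.2‖ ^ 2 ≤ Real.exp (2 * lam * T) / (2 * α) * ‖p.1‖ ^ 2 := by
  obtain ⟨u, hu, hu0, huw, hup⟩ := hp
  have hc := hu.continuous
  have hexp : ∀ t ≤ T, 1 ≤ Real.exp (2 * lam * T) * Real.exp (-(2 * lam) * t) := fun t ht => by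
    rw [← Real.exp_add]
    refine Real.one_le_exp ?_
    nlinarith
  have hpos : 0 < Real.exp (2 * lam * T) := Real.exp_pos _
  constructor
  · have hle : ‖p.2.1‖ ≤ √(Real.exp (2 * lam * T) * ‖p.1‖ ^ 2) := by
      refine (ContinuousMap.norm_le _ (Real.sqrt_nonneg _)).mpr fun t => ?_
      refine Real.le_sqrt_of_sq_le ?_
      rw [huw, ← hu0]
      have he := hu.energy hcoer t.2.1
      have hnn : 0 ≤ ∫ s in (0 : ℝ)..t, Real.exp (-(2 * lam) * s) * (2 * α * ‖u s‖ ^ 2) :=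
        intervalIntegral.integral_nonneg t.2.1 fun s _ => by positivity
      calc ‖i (u t)‖ ^ 2
          ≤ (Real.exp (2 * lam * T) * Real.exp (-(2 * lam) * t)) * ‖i (u t)‖ ^ 2 :=
            le_mul_of_one_le_left (by positivity) (hexp t t.2.2)
        _ = Real.exp (2 * lam * T) * (Real.exp (-(2 * lam) * t) * ‖i (u t)‖ ^ 2) := by ring
        _ ≤ _ := mul_le_mul_of_nonneg_left (by linarith) hpos.le
    exact (Real.le_sqrt (norm_nonneg _) (by positivity)).mp hle
  · rw [norm_sq_eq_intervalIntegral hT]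
    have hcongr : ∫ s in (0 : ℝ)..T, ‖p.2.2 s‖ ^ 2 = ∫ s in (0 : ℝ)..T, ‖u s‖ ^ 2 := by
      rw [intervalIntegral.integral_of_le hT, intervalIntegral.integral_of_le hT,
        integral_Ioc_eq_integral_Ioo, integral_Ioc_eq_integral_Ioo]
      refine integral_congr_ae ?_
      filter_upwards [hup] with s hs
      rw [hs]
    have he := hu.energy hcoer hT
    have hnn : 0 ≤ Real.exp (-(2 * lam) * T) * ‖i (u T)‖ ^ 2 := by positivity
    have hmono : ∫ s in (0 : ℝ)..T, ‖u s‖ ^ 2 ≤ ∫ s in (0 : ℝ)..T,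
        Real.exp (2 * lam * T) / (2 * α) * (Real.exp (-(2 * lam) * s) * (2 * α * ‖u s‖ ^ 2)) := by
      refine intervalIntegral.integral_mono_on hT (Continuous.intervalIntegrable (by fun_prop) _ _)
        (Continuous.intervalIntegrable (by fun_prop) _ _) fun s hs => ?_
      calc ‖u s‖ ^ 2
          ≤ (Real.exp (2 * lam * T) * Real.exp (-(2 * lam) * s)) * ‖u s‖ ^ 2 :=
            le_mul_of_one_le_left (by positivity) (hexp s hs.2)
        _ = _ := by field_simp
    rw [hcongr, ← hu0]
    refine hmono.trans ?_
    rw [intervalIntegral.integral_const_mul]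
    exact mul_le_mul_of_nonneg_left (by linarith) (by positivity)

theorem intervalIntegral_eq_inner_indicator {T t : ℝ} (ht : t ∈ Ico 0 T) (ℓ : V →L[ℝ] ℝ)
    (u : Lp V 2 (timeMeasure T)) :
    ∫ s in (0 : ℝ)..t, ℓ (u s) =
      ⟪indicatorConstLp 2 (measurableSet_Ioc (a := 0) (b := t)) (measure_ne_top (timeMeasure T) _)
        (1 : ℝ), ℓ.compLp u⟫_ℝ := by
  rw [L2.inner_indicatorConstLp_one, intervalIntegral.integral_of_le ht.1,
    Measure.restrict_restrict measurableSet_Ioc,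
    inter_eq_left.mpr (show Ioc 0 t ⊆ Ioo 0 T from fun s hs => ⟨hs.1, hs.2.trans_lt ht.2⟩)]
  have h := ae_restrict_Ioc_of_ae_timeMeasure ht.2 (ℓ.coeFn_compLp u)
  exact integral_congr_ae (h.mono fun s hs => hs.symm)

/-- Both conditions hold for strong solutions and are closed in the product topology, so they pass
to the closure. -/
theorem strongSolutions_closure_weak {i : V →L[ℝ] H} {a : V →L[ℝ] V →L[ℝ] ℝ} {T : ℝ} (hT : 0 ≤ T)
    {p : H × C(Icc 0 T, H) × Lp V 2 (timeMeasure T)}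
    (hp : p ∈ (strongSolutions i a T).topologicalClosure) :
    (∀ t (ht : t ∈ Ico 0 T) v, ⟪p.2.1 ⟨t, Ico_subset_Icc_self ht⟩, i v⟫_ℝ =
      ⟪p.1, i v⟫_ℝ - ∫ s in (0 : ℝ)..t, a (p.2.2 s) v) ∧
    ∀ᵐ t ∂timeMeasure T, IccExtend hT p.2.1 t = i (p.2.2 t) := by
  constructor
  · intro t ht v
    -- Written as an inner product with the indicator of `(0, t]`, the time integral is visibly
    -- continuous in the `L₂` class.
    have hflip : ∀ u : Lp V 2 (timeMeasure T), ∫ s in (0 : ℝ)..t, a (u s) v =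
        ⟪indicatorConstLp 2 (measurableSet_Ioc (a := 0) (b := t))
          (measure_ne_top (timeMeasure T) _) (1 : ℝ),
          (a.flip v).compLpL 2 (timeMeasure T) u⟫_ℝ :=
      intervalIntegral_eq_inner_indicator ht (a.flip v)
    rw [hflip]
    have hcl : IsClosed {p : H × C(Icc 0 T, H) × Lp V 2 (timeMeasure T) |
        ⟪p.2.1 ⟨t, Ico_subset_Icc_self ht⟩, i v⟫_ℝ = ⟪p.1, i v⟫_ℝ -
          ⟪indicatorConstLp 2 (measurableSet_Ioc (a := 0) (b := t))
            (measure_ne_top (timeMeasure T) _) (1 : ℝ),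
            (a.flip v).compLpL 2 (timeMeasure T) p.2.2⟫_ℝ} := by
      refine isClosed_eq ?_ ?_
      · exact ((continuous_eval_const _).comp continuous_snd.fst).inner continuous_const
      · exact (continuous_fst.inner continuous_const).sub (continuous_const.inner
          ((ContinuousLinearMap.continuous _).comp continuous_snd.snd))
    refine closure_minimal (fun q hq => ?_) hcl hp
    obtain ⟨u, hu, hu0, huw, hup⟩ := hq
    rw [mem_ofPred_eq, ← hflip, huw, ← hu0, hu.inner_eq]
    congr 1
    rw [intervalIntegral.integral_of_le ht.1, intervalIntegral.integral_of_le ht.1]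
    have h := ae_restrict_Ioc_of_ae_timeMeasure ht.2 hup
    exact integral_congr_ae (h.mono fun s hs => by simp [hs])
  · have key : continuousToL2 hT p.2.1 = i.compLpL 2 (timeMeasure T) p.2.2 := by
      have hcl : IsClosed {p : H × C(Icc 0 T, H) × Lp V 2 (timeMeasure T) |
          continuousToL2 hT p.2.1 = i.compLpL 2 (timeMeasure T) p.2.2} :=
        isClosed_eq ((ContinuousLinearMap.continuous _).comp continuous_snd.fst)
          ((ContinuousLinearMap.continuous _).comp continuous_snd.snd)
      refine closure_minimal (fun q hq => ?_) hcl hp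
      obtain ⟨u, hu, hu0, huw, hup⟩ := hq
      refine Lp.ext ?_
      filter_upwards [continuousToL2_ae hT q.2.1, i.coeFn_compLpL q.2.2, hup,
        ae_restrict_mem measurableSet_Ioo] with t h1 h2 h3 h4
      rw [h1, h2, h3, IccExtend_of_mem hT _ (Ioo_subset_Icc_self h4), huw]
    filter_upwards [continuousToL2_ae hT p.2.1, i.coeFn_compLpL p.2.2] with t h1 h2
    rw [← h1, key, h2]

/-- The map from the closed graph to the initial value is bounded below by the energy estimates,
hence has closed range. The range contains the eigenvectors, so it is all of `H`. -/
theorem exists_weakSolution [CompleteSpace V] [CompleteSpace H] {i : V →L[ℝ] H}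
    {a : V →L[ℝ] V →L[ℝ] ℝ}
    (hi : IsCompactOperator i) (hdense : ∀ x : H, (∀ v, ⟪x, i v⟫_ℝ = 0) → x = 0)
    (hsymm : ∀ u v, a u v = a v u) {T α lam : ℝ} (hT : 0 ≤ T) (hα : 0 < α) (hlam : 0 ≤ lam)
    (hcoer : ∀ v, α * ‖v‖ ^ 2 ≤ a v v + lam * ‖i v‖ ^ 2) (φ : H) :
    ∃ (w : C(Icc 0 T, H)) (u : Lp V 2 (timeMeasure T)),
      (∀ᵐ t ∂timeMeasure T, IccExtend hT w t = i (u t)) ∧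
      (∀ t (ht : t ∈ Ico 0 T) v, ⟪w ⟨t, Ico_subset_Icc_self ht⟩, i v⟫_ℝ =
        ⟪φ, i v⟫_ℝ - ∫ s in (0 : ℝ)..t, a (u s) v) ∧
      ‖w‖ ^ 2 ≤ Real.exp (2 * lam * T) * ‖φ‖ ^ 2 ∧
      ‖u‖ ^ 2 ≤ Real.exp (2 * lam * T) / (2 * α) * ‖φ‖ ^ 2 := by
  set N := (strongSolutions i a T).topologicalClosure
  have hbound : ∀ p ∈ N, ‖p.2.1‖ ^ 2 ≤ Real.exp (2 * lam * T) * ‖p.1‖ ^ 2 ∧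
      ‖p.2.2‖ ^ 2 ≤ Real.exp (2 * lam * T) / (2 * α) * ‖p.1‖ ^ 2 := fun p hp => by
    have h₁ : IsClosed {p : H × C(Icc 0 T, H) × Lp V 2 (timeMeasure T) |
        ‖p.2.1‖ ^ 2 ≤ Real.exp (2 * lam * T) * ‖p.1‖ ^ 2} :=
      isClosed_le (by fun_prop) (by fun_prop)
    have h₂ : IsClosed {p : H × C(Icc 0 T, H) × Lp V 2 (timeMeasure T) |
        ‖p.2.2‖ ^ 2 ≤ Real.exp (2 * lam * T) / (2 * α) * ‖p.1‖ ^ 2} :=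
      isClosed_le (by fun_prop) (by fun_prop)
    exact closure_minimal (fun q hq => strongSolutions_bound hT hα hlam hcoer hq) (h₁.inter h₂) hp
  have : CompleteSpace N := (strongSolutions i a T).isClosed_topologicalClosure.completeSpace_coe
  set f : N →L[ℝ] H := (ContinuousLinearMap.fst ℝ H _).comp N.subtypeL with hf
  have hanti : ∃ K, AntilipschitzWith K f := by
    set C₁ := Real.exp (2 * lam * T)
    set C₂ := Real.exp (2 * lam * T) / (2 * α)
    -- The norm of the triple is a maximum; the three summands control the initial value, the trace
    -- and the `L₂` class respectively.
    refine ⟨(1 + √C₁ + √C₂).toNNReal, ContinuousLinearMap.antilipschitz_of_bound f fun p => ?_⟩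
    rw [Real.coe_toNNReal _ (by positivity)]
    change ‖(p : H × C(Icc 0 T, H) × Lp V 2 (timeMeasure T))‖ ≤ _ * ‖p.1.1‖
    obtain ⟨h1, h2⟩ := hbound p p.2
    have aux : ∀ {x C : ℝ}, 0 ≤ C → x ^ 2 ≤ C * ‖p.1.1‖ ^ 2 → x ≤ √C * ‖p.1.1‖ :=
      fun hC h => le_of_abs_le (abs_le_of_sq_le_sq
        (by rw [mul_pow, Real.sq_sqrt hC]; exact h) (by positivity))
    have h1' := aux (by positivity) h1
    have h2' := aux (by positivity) h2
    have := Real.sqrt_nonneg C₁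
    have := Real.sqrt_nonneg C₂
    have := norm_nonneg p.1.1
    refine max_le ?_ (max_le ?_ ?_)
    · change ‖p.1.1‖ ≤ _
      nlinarith [mul_nonneg (Real.sqrt_nonneg C₁) this, mul_nonneg (Real.sqrt_nonneg C₂) this]
    · refine h1'.trans ?_
      nlinarith [mul_nonneg (Real.sqrt_nonneg C₁) this, mul_nonneg (Real.sqrt_nonneg C₂) this]
    · refine h2'.trans ?_
      nlinarith [mul_nonneg (Real.sqrt_nonneg C₁) this, mul_nonneg (Real.sqrt_nonneg C₂) this]
  obtain ⟨K, hK⟩ := hanti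
  have hclosed : IsClosed (f.range : Set H) := hK.isClosed_range f.uniformContinuous
  have : CompleteSpace f.range := hclosed.completeSpace_coe
  have hle : eigenSpan i a ≤ f.range := by
    refine (eigenSpan_le_map_strongSolutions i a T).trans ?_
    rintro _ ⟨p, hp, rfl⟩
    exact ⟨⟨p, Submodule.le_topologicalClosure _ hp⟩, rfl⟩
  have htop : f.range = ⊤ := by
    rw [← Submodule.orthogonal_eq_bot_iff, ← le_bot_iff,
      ← eigenSpan_orthogonal_eq_bot hi hdense hsymm hα hcoer]
    exact Submodule.orthogonal_le hle
  obtain ⟨p, hp⟩ : φ ∈ f.range := htop ▸ Submodule.mem_top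
  have hp1 : p.1.1 = φ := hp
  obtain ⟨h1, h2⟩ := strongSolutions_closure_weak hT p.2
  rw [← hp1]
  exact ⟨p.1.2.1, p.1.2.2, h2, h1, hbound p p.2⟩

end Existence

/-! ### Uniqueness by testing with eigenvectors -/

section Uniqueness

variable {V H : Type*} [NormedAddCommGroup V] [InnerProductSpace ℝ V]
  [NormedAddCommGroup H] [InnerProductSpace ℝ H]

/-- An integrable solution of `g = -κ ∫₀ g` on `(0, T)` has vanishing primitive. -/
theorem integral_eq_zero_of_ae_eq_mul_integral {T κ : ℝ} {g : ℝ → ℝ}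
    (hg : Integrable g (timeMeasure T))
    (h : ∀ᵐ t ∂timeMeasure T, g t = -κ * ∫ s in (0 : ℝ)..t, g s) {t : ℝ} (ht : t ∈ Ico 0 T) :
    ∫ s in (0 : ℝ)..t, g s = 0 := by
  -- Extension by zero makes the primitive continuous on the whole line without changing it on `[0,
  -- T)`.
  set f : ℝ → ℝ := (Ioo 0 T).indicator g with hf
  have hfi : Integrable f := (integrable_indicator_iff measurableSet_Ioo).mpr hg
  have hFG : ∀ x < T, 0 ≤ x → ∫ s in (0 : ℝ)..x, g s = ∫ s in (0 : ℝ)..x, f s := fun x hx h0 => by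
    rw [intervalIntegral.integral_of_le h0, intervalIntegral.integral_of_le h0]
    refine setIntegral_congr_fun measurableSet_Ioc fun s hs => ?_
    rw [hf, indicator_of_mem (show s ∈ Ioo 0 T from ⟨hs.1, hs.2.trans_lt hx⟩)]
  have hFc : Continuous fun x => ∫ s in (0 : ℝ)..x, f s :=
    intervalIntegral.continuous_primitive (fun _ _ => hfi.intervalIntegrable) 0
  -- The equation for `g` holds only almost everywhere. Integrating it once more shows that the
  -- primitive agrees on `[0, T)` with the `C¹` function `G`, to which Grönwall's argument `|G'| ≤
  -- |κ| |G|`, `G 0 = 0` applies.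
  set G : ℝ → ℝ := fun x => ∫ s in (0 : ℝ)..x, -κ * ∫ r in (0 : ℝ)..s, f r with hG
  have hGd : ∀ x, HasDerivAt G (-κ * ∫ r in (0 : ℝ)..x, f r) x := fun x =>
    (continuous_const.mul hFc).integral_hasStrictDerivAt 0 x |>.hasDerivAt
  have hGF : ∀ x ∈ Ico 0 T, ∫ s in (0 : ℝ)..x, f s = G x := fun x hx => by
    simp only [hG]
    rw [intervalIntegral.integral_of_le hx.1, intervalIntegral.integral_of_le hx.1]
    refine integral_congr_ae ?_
    filter_upwards [ae_restrict_Ioc_of_ae_timeMeasure hx.2 h, ae_restrict_mem measurableSet_Ioc]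
      with s hs hs'
    have hsT : s < T := hs'.2.trans_lt hx.2
    rw [hf, indicator_of_mem (show s ∈ Ioo 0 T from ⟨hs'.1, hsT⟩), hs, hFG s hsT hs'.1.le]
  rw [hFG t ht.2 ht.1, hGF t ht]
  exact eq_zero_of_abs_deriv_le_mul_abs_self_of_eq_zero_right (f := G) (K := |κ|)
    (a := 0) (b := t) (fun x _ => (hGd x).continuousAt.continuousWithinAt)
    (fun x _ => (hGd x).hasDerivWithinAt) (by simp [hG])
    (fun x hx => by rw [hGF x ⟨hx.1, hx.2.trans ht.2⟩, norm_mul]; simp) t ⟨ht.1, le_rfl⟩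

/-- By symmetry, testing with an eigenvector `e` gives a closed scalar equation for `⟪i z, i e⟫`,
whose primitive vanishes. So `w t` is orthogonal to all eigenvectors. -/
theorem weakSolution_eq_zero {i : V →L[ℝ] H} {a : V →L[ℝ] V →L[ℝ] ℝ}
    (hbot : (eigenSpan i a)ᗮ = ⊥) (hinj : Function.Injective i) (hsymm : ∀ u v, a u v = a v u)
    {T : ℝ} {z : Lp V 2 (timeMeasure T)} {w : ℝ → H}
    (hver : ∀ᵐ t ∂timeMeasure T, w t = i (z t))
    (hw : ∀ t ∈ Ioo 0 T, ∀ v, ⟪w t, i v⟫_ℝ = -∫ s in (0 : ℝ)..t, a (z s) v) : z = 0 := by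
  have hzi : Integrable z (timeMeasure T) := (Lp.memLp z).integrable (by norm_num)
  have hperp : ∀ t ∈ Ioo 0 T, w t = 0 := fun t ht => by
    rw [← Submodule.mem_bot ℝ, ← hbot, Submodule.mem_orthogonal']
    intro x hx
    refine Submodule.span_induction (p := fun x _ => ⟪w t, x⟫_ℝ = 0) ?_ (inner_zero_right _)
      (fun x y _ _ hx hy => by rw [inner_add_right, hx, hy, add_zero])
      (fun c x _ hx => by rw [inner_smul_right, hx, mul_zero]) hx
    rintro _ ⟨e, κ, rfl, he⟩
    have haz : ∀ s, a (z s) e = κ * ⟪i (z s), i e⟫_ℝ := fun s => by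
      rw [hsymm, he, real_inner_comm]
    have hwe : ∀ t ∈ Ioo 0 T, ⟪w t, i e⟫_ℝ = -κ * ∫ s in (0 : ℝ)..t, ⟪i (z s), i e⟫_ℝ :=
      fun t ht => by
        rw [hw t ht e]
        simp_rw [haz]
        rw [intervalIntegral.integral_const_mul, neg_mul]
    rw [hwe t ht, integral_eq_zero_of_ae_eq_mul_integral (κ := κ)
      ((i.integrable_comp hzi).inner_const (i e)) ?_ (Ioo_subset_Ico_self ht), mul_zero]
    filter_upwards [hver, ae_restrict_mem measurableSet_Ioo] with s hs hs'
    rw [← hs, hwe s hs']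
  refine Lp.ext ?_
  filter_upwards [hver, ae_restrict_mem measurableSet_Ioo, Lp.coeFn_zero V 2 (timeMeasure T)]
    with s hs hs' h0
  rw [h0, Pi.zero_apply]
  refine hinj ?_
  rw [map_zero, ← hs, hperp s hs']

end Uniqueness

/-! ### The space `H¹₀(G)` and its embedding in `L₂(G)` -/

theorem L2G.inner_eq_integral (f g : L2G) : ⟪f, g⟫_ℝ = ∫ x, f x * g x ∂spaceMeasure := by
  rw [L2.inner_def]
  refine integral_congr_ae (Filter.Eventually.of_forall fun x => ?_)
  simp [mul_comm]

/-- `H10.val` as a continuous linear map. -/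
def valL : H10 →L[ℝ] L2G := (WithLp.fstL 2 ℝ L2G L2G).comp (Submodule.subtypeL _)

/-- `H10.dx` as a continuous linear map. -/
def dxL : H10 →L[ℝ] L2G := (WithLp.sndL 2 ℝ L2G L2G).comp (Submodule.subtypeL _)

theorem valL_apply (h : H10) : valL h = h.val := rfl

theorem dxL_apply (h : H10) : dxL h = h.dx := rfl

theorem IsTestFunction.memLp {h : ℝ → ℝ} (hh : IsTestFunction h) : MemLp h 2 spaceMeasure :=
  hh.1.continuous.memLp_of_hasCompactSupport hh.2.1

theorem IsTestFunction.continuous_deriv {h : ℝ → ℝ} (hh : IsTestFunction h) :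
    Continuous (deriv h) :=
  hh.1.continuous_deriv (by simp)

theorem IsTestFunction.memLp_deriv {h : ℝ → ℝ} (hh : IsTestFunction h) :
    MemLp (deriv h) 2 spaceMeasure :=
  hh.continuous_deriv.memLp_of_hasCompactSupport hh.2.1.deriv

theorem IsTestFunction.hasDerivAt {h : ℝ → ℝ} (hh : IsTestFunction h) (x : ℝ) :
    HasDerivAt h (deriv h x) x :=
  (hh.1.differentiable (by simp) x).hasDerivAt

/-- The element of `H¹₀(G)` given by a test function. -/
def IsTestFunction.toH10 {h : ℝ → ℝ} (hh : IsTestFunction h) : H10 :=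
  ⟨WithLp.toLp 2 (hh.memLp.toLp, hh.memLp_deriv.toLp), Submodule.le_topologicalClosure _
    ⟨h, hh, hh.memLp.coeFn_toLp, hh.memLp_deriv.coeFn_toLp⟩⟩

theorem IsTestFunction.val_toH10 {h : ℝ → ℝ} (hh : IsTestFunction h) :
    hh.toH10.val =ᵐ[spaceMeasure] h := hh.memLp.coeFn_toLp

theorem IsTestFunction.dx_toH10 {h : ℝ → ℝ} (hh : IsTestFunction h) :
    hh.toH10.dx =ᵐ[spaceMeasure] deriv h := hh.memLp_deriv.coeFn_toLp

theorem H10.induction {P : H10 → Prop} (hcl : IsClosed {v | P v})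
    (htest : ∀ (h : ℝ → ℝ) (hh : IsTestFunction h), P hh.toH10) (v : H10) : P v := by
  have hd : Dense {v : H10 | ∃ (h : ℝ → ℝ) (hh : IsTestFunction h), v = hh.toH10} := by
    rw [Subtype.dense_iff]
    intro p hp
    refine closure_mono (fun q hq => ?_) hp
    obtain ⟨h, hh, h1, h2⟩ := hq
    refine ⟨hh.toH10, ⟨h, hh, rfl⟩, ?_⟩
    refine WithLp.ofLp_injective 2 (Prod.ext (Lp.ext ?_) (Lp.ext ?_))
    · exact hh.val_toH10.trans h1.symm
    · exact hh.dx_toH10.trans h2.symm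
  refine closure_minimal ?_ hcl (hd v)
  rintro _ ⟨h, hh, rfl⟩
  exact htest h hh

theorem eq_zero_of_forall_test {x : L2G}
    (hx : ∀ k : ℝ → ℝ, IsTestFunction k → ∫ y, k y * x y ∂spaceMeasure = 0) : x = 0 := by
  have hint : Integrable x spaceMeasure := (Lp.memLp x).integrable (by norm_num)
  refine Lp.ext ?_
  have h : ∀ᵐ y ∂spaceMeasure, y ∈ Ioo 0 Real.pi → x y = 0 :=
    isOpen_Ioo.ae_eq_zero_of_integral_contDiff_smul_eq_zero
      (hint.locallyIntegrable.locallyIntegrableOn _)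
      fun k h1 h2 h3 => hx k ⟨h1, h2, h3⟩
  filter_upwards [h, ae_restrict_mem measurableSet_Ioo, Lp.coeFn_zero ℝ 2 spaceMeasure]
    with y hy hy' h0
  rw [h0, hy hy', Pi.zero_apply]

theorem eq_zero_of_forall_inner_valL {x : L2G} (hx : ∀ v : H10, ⟪x, valL v⟫_ℝ = 0) : x = 0 := by
  refine eq_zero_of_forall_test fun k hk => ?_
  rw [← hx hk.toH10, L2G.inner_eq_integral]
  refine integral_congr_ae ?_
  filter_upwards [hk.val_toH10] with y hy
  rw [valL_apply, hy, mul_comm]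

/-- Both sides are continuous in `v`, so test functions suffice; there the integrands vanish outside
`G`, and integration by parts on the line has no boundary terms. -/
theorem inner_dx_eq_neg_inner_val (v : H10) {k : ℝ → ℝ} (hk : IsTestFunction k) :
    ⟪v.dx, hk.toH10.val⟫_ℝ = -⟪v.val, hk.toH10.dx⟫_ℝ := by
  refine H10.induction (P := fun v => ⟪dxL v, hk.toH10.val⟫_ℝ = -⟪valL v, hk.toH10.dx⟫_ℝ)
    (isClosed_eq (by fun_prop) (by fun_prop)) (fun h hh => ?_) v
  have e1 : ⟪dxL hh.toH10, hk.toH10.val⟫_ℝ = ∫ x, deriv h x * k x := by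
    rw [L2G.inner_eq_integral,
      ← setIntegral_eq_integral_of_forall_compl_eq_zero (s := Ioo 0 Real.pi) (μ := volume)
        (f := fun x => deriv h x * k x)]
    · refine integral_congr_ae ?_
      filter_upwards [hh.dx_toH10, hk.val_toH10] with x h1 h2
      rw [dxL_apply, h1, h2]
    · intro x hx
      rw [image_eq_zero_of_notMem_tsupport fun h => hx (hk.2.2 h), mul_zero]
  have e2 : ⟪valL hh.toH10, hk.toH10.dx⟫_ℝ = ∫ x, h x * deriv k x := by
    rw [L2G.inner_eq_integral,
      ← setIntegral_eq_integral_of_forall_compl_eq_zero (s := Ioo 0 Real.pi) (μ := volume)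
        (f := fun x => h x * deriv k x)]
    · refine integral_congr_ae ?_
      filter_upwards [hh.val_toH10, hk.dx_toH10] with x h1 h2
      rw [valL_apply, h1, h2]
    · intro x hx
      rw [image_eq_zero_of_notMem_tsupport fun h => hx (hh.2.2 h), zero_mul]
  rw [e1, e2, integral_mul_deriv_eq_deriv_mul_of_integrable (u := h) (v := k) (u' := deriv h)
    (v' := deriv k) (fun x _ => hh.hasDerivAt x) (fun x _ => hk.hasDerivAt x), neg_neg]
  · exact (hh.1.continuous.mul hk.continuous_deriv).integrable_of_hasCompactSupport
      hh.2.1.mul_right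
  · exact (hh.continuous_deriv.mul hk.1.continuous).integrable_of_hasCompactSupport
      hk.2.1.mul_left
  · exact (hh.1.continuous.mul hk.1.continuous).integrable_of_hasCompactSupport
      hh.2.1.mul_right

/-- Elements of `H10` are pairs, so this is the closability of the derivative: if `v = 0`,
integration by parts makes `v.dx` orthogonal to every test function. -/
theorem valL_injective : Function.Injective valL := by
  refine (injective_iff_map_eq_zero valL).mpr fun v hv => ?_
  have hdx : v.dx = 0 := by
    refine eq_zero_of_forall_test fun k hk => ?_
    have h := inner_dx_eq_neg_inner_val v hk
    rw [← valL_apply v, hv, inner_zero_left, neg_zero, L2G.inner_eq_integral] at h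
    rw [← h]
    refine integral_congr_ae ?_
    filter_upwards [hk.val_toH10] with y hy
    rw [hy, mul_comm]
  have := H10.norm_sq v
  rw [← valL_apply v, hv, hdx] at this
  simpa using this

/-! ### Compactness of the embedding by finite-rank sampling -/

/-- The indicator of `(y, x]` in `L₂(G)`. -/
def indicatorL2G (y x : ℝ) : L2G :=
  indicatorConstLp 2 (measurableSet_Ioc (a := y) (b := x)) (measure_ne_top spaceMeasure _) 1

theorem norm_indicatorL2G_le {y x : ℝ} (hyx : y ≤ x) : ‖indicatorL2G y x‖ ≤ √(x - y) := by
  rw [indicatorL2G, norm_indicatorConstLp (by norm_num) (by norm_num), norm_one, one_mul,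
    Real.sqrt_eq_rpow]
  refine Real.rpow_le_rpow measureReal_nonneg ?_ (by norm_num)
  rw [measureReal_def, ← ENNReal.toReal_ofReal (sub_nonneg.mpr hyx), ← Real.volume_Ioc]
  exact ENNReal.toReal_mono (by simp) (Measure.restrict_apply_le _ _)

theorem IsTestFunction.inner_indicatorL2G {h : ℝ → ℝ} (hh : IsTestFunction h) {y x : ℝ}
    (hy : 0 ≤ y) (hyx : y ≤ x) (hx : x < Real.pi) :
    ⟪indicatorL2G y x, hh.toH10.dx⟫_ℝ = h x - h y := by
  rw [indicatorL2G, L2.inner_indicatorConstLp_one, Measure.restrict_restrict measurableSet_Ioc,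
    inter_eq_left.mpr (show Ioc y x ⊆ Ioo 0 Real.pi from
      fun s hs => ⟨hy.trans_lt hs.1, hs.2.trans_lt hx⟩),
    ← intervalIntegral.integral_eq_sub_of_hasDerivAt (fun s _ => hh.hasDerivAt s)
      (hh.continuous_deriv.intervalIntegrable _ _), intervalIntegral.integral_of_le hyx]
  refine integral_congr_ae (ae_restrict_of_ae_restrict_of_subset
    (show Ioc y x ⊆ Ioo 0 Real.pi from fun s hs => ⟨hy.trans_lt hs.1, hs.2.trans_lt hx⟩)
    hh.dx_toH10)

/-- The `m`-th of `n` cells of length `π / n`. -/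
def cell (n m : ℕ) : Set ℝ := (fun x : ℝ => ⌊n * x / Real.pi⌋₊) ⁻¹' {m}

theorem measurableSet_cell (n m : ℕ) : MeasurableSet (cell n m) :=
  (Nat.measurable_floor.comp (by fun_prop)) (measurableSet_singleton m)

/-- Sampling of an element of `H¹₀(G)` at the left ends of `n` cells. -/
def sample (n : ℕ) : H10 →L[ℝ] L2G :=
  ∑ m ∈ Finset.range n, ((innerSL ℝ (indicatorL2G 0 (m * Real.pi / n))).comp dxL).smulRight
    (indicatorConstLp 2 (measurableSet_cell n m) (measure_ne_top spaceMeasure _) (1 : ℝ))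

theorem isCompactOperator_smulRight {E F : Type*} [NormedAddCommGroup E] [NormedSpace ℝ E]
    [NormedAddCommGroup F] [NormedSpace ℝ F] (ℓ : E →L[ℝ] ℝ) (y : F) :
    IsCompactOperator (ℓ.smulRight y) := by
  have h : IsCompactOperator ℓ :=
    isCompactOperator_of_locallyCompactSpace_dom ℓ
  exact h.clm_comp (ContinuousLinearMap.toSpanSingleton ℝ y)

theorem isCompactOperator_of_norm_sub_le {E F : Type*} [NormedAddCommGroup E] [NormedSpace ℝ E]
    [NormedAddCommGroup F] [NormedSpace ℝ F] [CompleteSpace F] {A : ℕ → E →L[ℝ] F} {B : E →L[ℝ] F}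
    {c : ℕ → ℝ} (hA : ∀ n, IsCompactOperator (A n))
    (hAB : ∀ᶠ n in Filter.atTop, ‖A n - B‖ ≤ c n)
    (hc : Filter.Tendsto c Filter.atTop (nhds 0)) : IsCompactOperator B := by
  have htend : Filter.Tendsto A Filter.atTop (nhds B) := by
    rw [tendsto_iff_norm_sub_tendsto_zero]
    exact squeeze_zero' (Filter.Eventually.of_forall fun _ => norm_nonneg _) hAB hc
  exact isCompactOperator_of_tendsto htend (Filter.Eventually.of_forall hA)

theorem isCompactOperator_sample (n : ℕ) : IsCompactOperator (sample n) :=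
  (Submodule.sum_mem (compactOperator (RingHom.id ℝ) H10 L2G) fun _ _ =>
    isCompactOperator_smulRight _ _ : sample n ∈ compactOperator (RingHom.id ℝ) H10 L2G)

theorem sample_ae {n : ℕ} (hn : 0 < n) (v : H10) : ∀ᵐ x ∂spaceMeasure, sample n v x =
    ⟪indicatorL2G 0 ((⌊n * x / Real.pi⌋₊ : ℕ) * Real.pi / n), v.dx⟫_ℝ := by
  have hsum : ∀ s : Finset ℕ, ∀ᵐ x ∂spaceMeasure,
      (∑ m ∈ s, ⟪indicatorL2G 0 (m * Real.pi / n), v.dx⟫_ℝ • indicatorConstLp 2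
        (measurableSet_cell n m) (measure_ne_top spaceMeasure _) (1 : ℝ) : L2G) x =
      ∑ m ∈ s, if ⌊n * x / Real.pi⌋₊ = m then ⟪indicatorL2G 0 (m * Real.pi / n), v.dx⟫_ℝ else 0 := by
    intro s
    induction s using Finset.induction_on with
    | empty =>
      filter_upwards [Lp.coeFn_zero ℝ 2 spaceMeasure] with x hx
      simpa using hx
    | insert m s hm ih =>
      rw [Finset.sum_insert hm]
      filter_upwards [ih, Lp.coeFn_add (⟪indicatorL2G 0 (m * Real.pi / n), v.dx⟫_ℝ •
          indicatorConstLp 2 (measurableSet_cell n m) (measure_ne_top spaceMeasure _) (1 : ℝ)) _,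
        Lp.coeFn_smul ⟪indicatorL2G 0 (m * Real.pi / n), v.dx⟫_ℝ
          (indicatorConstLp 2 (measurableSet_cell n m) (measure_ne_top spaceMeasure _) (1 : ℝ)),
        indicatorConstLp_coeFn (p := 2) (hs := measurableSet_cell n m)
          (hμs := measure_ne_top spaceMeasure _) (c := (1 : ℝ))] with x h1 h2 h3 h4
      rw [h2, Pi.add_apply, h1, h3, Pi.smul_apply, h4, Finset.sum_insert hm]
      have hmem : x ∈ cell n m ↔ ⌊n * x / Real.pi⌋₊ = m := Iff.rfl
      by_cases hx : ⌊n * x / Real.pi⌋₊ = m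
      · rw [indicator_of_mem (hmem.mpr hx), if_pos hx, smul_eq_mul, mul_one]
      · rw [indicator_of_notMem (fun h => hx (hmem.mp h)), if_neg hx, smul_zero]
  filter_upwards [hsum (Finset.range n), ae_restrict_mem measurableSet_Ioo] with x hx hx'
  have happ : sample n v = ∑ m ∈ Finset.range n, ⟪indicatorL2G 0 (m * Real.pi / n), v.dx⟫_ℝ •
      indicatorConstLp 2 (measurableSet_cell n m) (measure_ne_top spaceMeasure _) (1 : ℝ) := by
    simp [sample, dxL_apply]
  rw [happ, hx, Finset.sum_ite_eq, if_pos]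
  -- Since `x < π`, the index of the cell of `x` is below `n`, so exactly one summand survives.
  rw [Finset.mem_range, Nat.floor_lt (by have := hx'.1; positivity), div_lt_iff₀ Real.pi_pos]
  exact mul_lt_mul_of_pos_left hx'.2 (by positivity)

/-- For a test function, Cauchy–Schwarz gives `|h x - h y| ≤ √(x - y) ‖h'‖₀`, and a point lies
within `π / n` of the left end of its cell. The estimate is closed in `v`, so it extends from test
functions by density. -/
theorem norm_valL_sub_sample_le {n : ℕ} (hn : 0 < n) (v : H10) :
    ‖valL v - sample n v‖ ≤
      spaceMeasure.real univ ^ (2 : ℝ≥0∞).toReal⁻¹ * (√(Real.pi / n) * ‖dxL v‖) := by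
  refine H10.induction (P := fun v => ‖valL v - sample n v‖ ≤
      spaceMeasure.real univ ^ (2 : ℝ≥0∞).toReal⁻¹ * (√(Real.pi / n) * ‖dxL v‖))
    (isClosed_le (by fun_prop) (by fun_prop)) (fun h hh => ?_) v
  refine Lp.norm_le_of_ae_bound (by positivity) ?_
  filter_upwards [Lp.coeFn_sub (valL hh.toH10) (sample n hh.toH10), sample_ae hn hh.toH10,
    hh.val_toH10, ae_restrict_mem measurableSet_Ioo] with x h1 h2 h3 hx
  have hn' : (0 : ℝ) < n := by exact_mod_cast hn
  have hpi := Real.pi_pos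
  have hx0 : 0 < x := hx.1
  set y : ℝ := (⌊n * x / Real.pi⌋₊ : ℕ) * Real.pi / n with hy
  have hy0 : 0 ≤ y := by positivity
  have hyx : y ≤ x := by
    have := Nat.floor_le (a := n * x / Real.pi) (by positivity)
    rw [hy, div_le_iff₀ hn']
    rw [le_div_iff₀ hpi] at this
    linarith
  have hxy : x - y ≤ Real.pi / n := by
    have := (Nat.lt_floor_add_one (n * x / Real.pi)).le
    rw [div_le_iff₀ hpi] at this
    rw [hy, le_div_iff₀ hn', sub_mul, div_mul_cancel₀ _ hn'.ne']
    linarith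
  -- The sample is `∫₀^y h' = h y - h 0`, and `h 0 = 0` because `0` lies outside the support.
  have hsub : h x - (h y - h 0) = ⟪indicatorL2G y x, hh.toH10.dx⟫_ℝ := by
    rw [hh.inner_indicatorL2G hy0 hyx hx.2,
      image_eq_zero_of_notMem_tsupport fun h0 => lt_irrefl 0 (hh.2.2 h0).1, sub_zero]
  rw [h1, Pi.sub_apply, valL_apply, h2, h3,
    hh.inner_indicatorL2G le_rfl hy0 (hyx.trans_lt hx.2), hsub]
  refine (norm_inner_le_norm _ _).trans ?_
  exact mul_le_mul_of_nonneg_right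
    ((norm_indicatorL2G_le hyx).trans (Real.sqrt_le_sqrt hxy)) (norm_nonneg _)

theorem isCompactOperator_valL : IsCompactOperator valL := by
  set M := spaceMeasure.real univ ^ (2 : ℝ≥0∞).toReal⁻¹
  have hlim : Filter.Tendsto (fun n : ℕ => M * (√(Real.pi / n) * ‖dxL‖)) Filter.atTop (nhds 0) := by
    have h := ((Real.continuous_sqrt.tendsto 0).comp
      (tendsto_const_div_atTop_nhds_zero_nat Real.pi)).mul_const ‖dxL‖ |>.const_mul M
    simpa using h
  have hbound : ∀ᶠ n : ℕ in Filter.atTop,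
      ‖sample n - valL‖ ≤ M * (√(Real.pi / n) * ‖dxL‖) := by
    filter_upwards [Filter.eventually_gt_atTop 0] with n hn
    refine ContinuousLinearMap.opNorm_le_bound _ (by positivity) fun v => ?_
    rw [sub_apply, norm_sub_rev]
    refine (norm_valL_sub_sample_le hn v).trans ?_
    rw [mul_assoc, mul_assoc]
    gcongr
    exact dxL.le_opNorm v
  exact isCompactOperator_of_norm_sub_le isCompactOperator_sample hbound hlim

/-! ### The form of the rough heat equation -/

/-- Multiplication by a function in `L_∞(G)`. -/
def mulL (W : LinftyG) : L2G →L[ℝ] L2G :=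
  (ContinuousLinearMap.mul ℝ ℝ).holderL spaceMeasure ∞ 2 2 W

theorem mulL_ae (W : LinftyG) (f : L2G) : mulL W f =ᵐ[spaceMeasure] fun x => W x * f x :=
  (ContinuousLinearMap.mul ℝ ℝ).coeFn_holder W f

theorem norm_mulL_le (W : LinftyG) (f : L2G) : ‖mulL W f‖ ≤ ‖W‖ * ‖f‖ := by
  refine ((ContinuousLinearMap.mul ℝ ℝ).norm_holder_apply_apply_le W f).trans ?_
  rw [mul_assoc]
  exact mul_le_of_le_one_left (by positivity) (ContinuousLinearMap.opNorm_mul_le ℝ ℝ)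

theorem inner_mulL_left (W : LinftyG) (f g : L2G) : ⟪mulL W f, g⟫_ℝ = ⟪f, mulL W g⟫_ℝ := by
  rw [L2G.inner_eq_integral, L2G.inner_eq_integral]
  refine integral_congr_ae ?_
  filter_upwards [mulL_ae W f, mulL_ae W g] with x h1 h2
  rw [h1, h2]
  ring

/-- The form `(u_x + u W, h')₀`. -/
def fluxForm (W : LinftyG) : H10 →L[ℝ] H10 →L[ℝ] ℝ :=
  (isBoundedBilinearMap_inner (𝕜 := ℝ) (E := L2G)).toContinuousLinearMap.bilinearComp
    (dxL + (mulL W).comp valL) dxL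

/-- The form `(u_x W, h)₀`. -/
def driftForm (W : LinftyG) : H10 →L[ℝ] H10 →L[ℝ] ℝ :=
  (isBoundedBilinearMap_inner (𝕜 := ℝ) (E := L2G)).toContinuousLinearMap.bilinearComp
    ((mulL W).comp dxL) valL

theorem fluxForm_apply (W : LinftyG) (u h : H10) :
    fluxForm W u h = ⟪dxL u + mulL W (valL u), dxL h⟫_ℝ := rfl

theorem driftForm_apply (W : LinftyG) (u h : H10) :
    driftForm W u h = ⟪mulL W (dxL u), valL h⟫_ℝ := rfl

/-- The form `(u_x + u W, h')₀ + (u_x W, h)₀` of the problem. -/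
def grpForm (W : LinftyG) : H10 →L[ℝ] H10 →L[ℝ] ℝ := fluxForm W + driftForm W

theorem grpForm_apply (W : LinftyG) (u h : H10) :
    grpForm W u h = fluxForm W u h + driftForm W u h := rfl

theorem grpForm_symm (W : LinftyG) (u h : H10) : grpForm W u h = grpForm W h u := by
  simp only [grpForm_apply, fluxForm_apply, driftForm_apply, inner_add_left, inner_mulL_left]
  rw [real_inner_comm (dxL u), ← inner_mulL_left W (valL u), ← inner_mulL_left W (dxL u),
    real_inner_comm (dxL h) (mulL W (valL u)), real_inner_comm (valL h) (mulL W (dxL u))]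
  ring

/-- On the diagonal the two `W` terms add up to `2 (Wv, v')₀`, which is at least `-½‖v'‖₀² -
2‖W‖²‖v‖₀²`; the extra `½` in the constant completes `½‖v'‖₀²` to `½‖v‖₁²`. -/
theorem grpForm_garding (W : LinftyG) (v : H10) :
    1 / 2 * ‖v‖ ^ 2 ≤ grpForm W v v + (2 * ‖W‖ ^ 2 + 1 / 2) * ‖valL v‖ ^ 2 := by
  have h1 : |⟪mulL W (valL v), dxL v⟫_ℝ| ≤ ‖W‖ * ‖valL v‖ * ‖dxL v‖ :=
    (abs_real_inner_le_norm _ _).trans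
      (mul_le_mul_of_nonneg_right (norm_mulL_le W _) (norm_nonneg _))
  rw [grpForm_apply, fluxForm_apply, driftForm_apply, inner_add_left, real_inner_self_eq_norm_sq,
    inner_mulL_left W (dxL v),
    real_inner_comm (mulL W (valL v)) (dxL v), H10.norm_sq, ← valL_apply, ← dxL_apply]
  have h2 := (abs_le.mp h1).1
  nlinarith [sq_nonneg (‖dxL v‖ - 2 * (‖W‖ * ‖valL v‖))]

/-- This links the concrete definition to the abstract theory. The flux and drift integrals may be
merged because an `L₂` class is integrable on the finite interval. -/
theorem isGeneralizedGRPSolution_iff {T : ℝ} {W : LinftyG} {φ : L2G} {u : L2H10 T} :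
    IsGeneralizedGRPSolution T W φ u ↔ ∃ w : ℝ → L2G, IsL2Version T u w ∧
      ∀ t ∈ Ioo 0 T, ∀ h : H10, ⟪w t, valL h⟫_ℝ =
        ⟪φ, valL h⟫_ℝ - ∫ s in (0 : ℝ)..t, grpForm W (u s) h := by
  have hu : Integrable u (timeMeasure T) := (Lp.memLp u).integrable (by norm_num)
  have hint : ∀ (a : H10 →L[ℝ] H10 →L[ℝ] ℝ) (h : H10), ∀ t ∈ Ioo 0 T,
      IntervalIntegrable (fun s => a (u s) h) volume 0 t := fun a h t ht => by
    rw [intervalIntegrable_iff_integrableOn_Ioc_of_le ht.1.le]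
    exact ((a.flip h).integrable_comp hu).mono_measure (Measure.restrict_mono
      (show Ioc 0 t ⊆ Ioo 0 T from fun _ hs => ⟨hs.1, hs.2.trans_lt ht.2⟩) le_rfl)
  have hflux : ∀ (v h : H10),
      ∫ x, (v.dx x + W x * v.val x) * h.dx x ∂spaceMeasure = fluxForm W v h := fun v h => by
    rw [fluxForm_apply, L2G.inner_eq_integral]
    refine integral_congr_ae ?_
    filter_upwards [mulL_ae W (valL v), Lp.coeFn_add (dxL v) (mulL W (valL v))] with x h1 h2
    rw [h2, Pi.add_apply, h1]
    rfl
  have hdrift : ∀ (v h : H10),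
      ∫ x, (-W x * v.dx x + 0 * v.val x) * h.val x ∂spaceMeasure = -driftForm W v h :=
    fun v h => by
      rw [driftForm_apply, L2G.inner_eq_integral, ← integral_neg]
      refine integral_congr_ae ?_
      filter_upwards [mulL_ae W (dxL v)] with x h1
      rw [h1]
      simp [dxL_apply, valL_apply]
  have key : ∀ (h : H10), ∀ t ∈ Ioo 0 T, ∫ s in (0 : ℝ)..t, grpForm W (u s) h =
      (∫ s in (0 : ℝ)..t, fluxForm W (u s) h) + ∫ s in (0 : ℝ)..t, driftForm W (u s) h :=
    fun h t ht => intervalIntegral.integral_add (hint _ h t ht) (hint _ h t ht)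
  unfold IsGeneralizedGRPSolution IsGeneralizedSolution
  refine exists_congr fun w => and_congr_right fun _ => ⟨fun H t ht h => ?_, fun H h t ht => ?_⟩
  · have := H h t ht
    simp only [hflux, hdrift, intervalIntegral.integral_neg, zero_apply,
      intervalIntegral.integral_zero] at this
    rw [L2G.inner_eq_integral, L2G.inner_eq_integral, key h t ht, valL_apply, this]
    ring
  · have := H t ht h
    simp only [hflux, hdrift, intervalIntegral.integral_neg, zero_apply,
      intervalIntegral.integral_zero]
    rw [L2G.inner_eq_integral, L2G.inner_eq_integral, key h t ht, valL_apply] at this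
    rw [this]
    ring

theorem eigenSpan_grpForm_orthogonal (W : LinftyG) : (eigenSpan valL (grpForm W))ᗮ = ⊥ :=
  eigenSpan_orthogonal_eq_bot isCompactOperator_valL (fun _ => eq_zero_of_forall_inner_valL)
    (grpForm_symm W) (by norm_num : (0 : ℝ) < 1 / 2) (grpForm_garding W)

theorem IsGeneralizedGRPSolution.unique {T : ℝ} {W : LinftyG} {φ : L2G} {u v : L2H10 T}
    (hu : IsGeneralizedGRPSolution T W φ u) (hv : IsGeneralizedGRPSolution T W φ v) : v = u := by
  obtain ⟨w, hwu, hw⟩ := isGeneralizedGRPSolution_iff.mp hu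
  obtain ⟨y, hyv, hy⟩ := isGeneralizedGRPSolution_iff.mp hv
  rw [← sub_eq_zero]
  refine weakSolution_eq_zero (w := fun t => y t - w t) (eigenSpan_grpForm_orthogonal W)
    valL_injective (grpForm_symm W) ?_ fun t ht h => ?_
  · filter_upwards [hwu, hyv, Lp.coeFn_sub v u] with t h1 h2 h3
    rw [h1, h2, h3, Pi.sub_apply, map_sub]
    rfl
  · have hi : ∀ z : L2H10 T, IntervalIntegrable (fun s => grpForm W (z s) h) volume 0 t :=
      fun z => by
        rw [intervalIntegrable_iff_integrableOn_Ioc_of_le ht.1.le]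
        exact (((grpForm W).flip h).integrable_comp
          ((Lp.memLp z).integrable (by norm_num))).mono_measure (Measure.restrict_mono
            (show Ioc 0 t ⊆ Ioo 0 T from fun _ hs => ⟨hs.1, hs.2.trans_lt ht.2⟩) le_rfl)
    have hsub : ∫ s in (0 : ℝ)..t, grpForm W ((v - u : L2H10 T) s) h =
        (∫ s in (0 : ℝ)..t, grpForm W (v s) h) - ∫ s in (0 : ℝ)..t, grpForm W (u s) h := by
      rw [← intervalIntegral.integral_sub (hi v) (hi u), intervalIntegral.integral_of_le ht.1.le,
        intervalIntegral.integral_of_le ht.1.le]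
      refine integral_congr_ae ?_
      filter_upwards [ae_restrict_Ioc_of_ae_timeMeasure ht.2 (Lp.coeFn_sub v u)] with s hs
      rw [hs, Pi.sub_apply, map_sub, sub_apply]
    rw [hsub, inner_sub_left, hw t ht h, hy t ht h]
    ring

end HeatGRP

end

theorem theorem3p1 :
    ∃ C : ℝ → ℝ → ℝ, ∀ (T : ℝ), 0 < T → ∀ (W : HeatGRP.LinftyG) (φ : HeatGRP.L2G),
      ∃ u : HeatGRP.L2H10 T,
        HeatGRP.IsGeneralizedGRPSolution T W φ u ∧
        (∀ v : HeatGRP.L2H10 T, HeatGRP.IsGeneralizedGRPSolution T W φ v → v = u) ∧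
        ∃ w : ℝ → HeatGRP.L2G,
          HeatGRP.IsL2Version T u w ∧
          ContinuousOn w (Ioo 0 T) ∧
          BddAbove ((fun t => ‖w t‖ ^ 2) '' Ioo 0 T) ∧
          sSup ((fun t => ‖w t‖ ^ 2) '' Ioo 0 T) + ∫ s in (0 : ℝ)..T, ‖u s‖ ^ 2
            ≤ C T ‖W‖ * ‖φ‖ ^ 2 := by
  -- With `α = 1/2` both energy bounds have the constant `exp(2 lam T)`, where `lam = 2K² + 1/2`;
  -- the factor `2` is their sum.
  refine ⟨fun T K => 2 * Real.exp (2 * (2 * K ^ 2 + 1 / 2) * T), fun T hT W φ => ?_⟩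
  obtain ⟨w, u, hver, hweak, hw, hu⟩ := HeatGRP.exists_weakSolution
    HeatGRP.isCompactOperator_valL (fun _ => HeatGRP.eq_zero_of_forall_inner_valL)
    (HeatGRP.grpForm_symm W) hT.le (by norm_num : (0 : ℝ) < 1 / 2) (by positivity)
    (HeatGRP.grpForm_garding W) φ
  have hsol : HeatGRP.IsGeneralizedGRPSolution T W φ u := by
    refine HeatGRP.isGeneralizedGRPSolution_iff.mpr ⟨IccExtend hT.le w, hver, fun t ht h => ?_⟩
    rw [IccExtend_of_mem hT.le w (Ioo_subset_Icc_self ht)]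
    exact hweak t (Ioo_subset_Ico_self ht) h
  have hle : ∀ y ∈ (fun t => ‖IccExtend hT.le w t‖ ^ 2) '' Ioo 0 T, y ≤ ‖w‖ ^ 2 := by
    rintro _ ⟨t, -, rfl⟩
    exact pow_le_pow_left₀ (norm_nonneg _) (w.norm_coe_le_norm _) 2
  refine ⟨u, hsol, fun v hv => hsol.unique hv, IccExtend hT.le w, hver,
    w.continuous.Icc_extend'.continuousOn, ⟨_, hle⟩, ?_⟩
  have hsup := csSup_le ((nonempty_Ioo.mpr hT).image _) hle
  rw [← HeatGRP.norm_sq_eq_intervalIntegral hT.le]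
  norm_num at hu hw ⊢
  linarith
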